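/- Let $c>0$ and $\eta$ be real and consider the series $$S(\eta,c;x)=\sum_{k=0}^{\infty}\Bigl(\frac{1-x}{1+\eta}\Bigr)^{k}\,{}_2F_1\Bigl(\frac k2+\frac12,\frac k2+1;c;x\Bigr),$$ where ${}_2F_1(a,b;c;x)=\sum_{n\ge 0}\frac{(a)_n(b)_n}{(c)_n}\frac{x^n}{n!}$ for $|x|<1$, and for real $x\le -1$ the symbol ${}_2F_1(a,b;c;x)$ denotes the value of the analytic continuation of this sum to $(-\infty,1)$. The series $S(\eta,c;x)$ is absolutely convergent (i) for $0<x<1$, provided $\eta>\sqrt{x}$ if $0<c\le\frac32$, and provided $\eta\ge\sqrt{x}$ if $c>\frac32$; (ii) for $x<0$, provided $\eta>\sqrt{1+|x|}-1$ if $0<c\le\frac32$, and provided $\eta\ge\sqrt{1+|x|}-1$ if $c>\frac32$. -/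

import Mathlib

namespace GaussSum

section

open Set Filter Topology

/-- `f` is a real-analytic function on `(-∞, 1)` that agrees on `(-1, 1)` with the sum of the Gauss
series `∑ n, (a)_n (b)_n / ((c)_n n!) x ^ n`, i.e. `f` is the restriction to `(-∞, 1)` of (the
principal branch of) the hypergeometric function with parameters `a, b; c`. -/
def IsAnalyticContinuation (a b c : ℝ) (f : ℝ → ℝ) : Prop :=
  AnalyticOnNhd ℝ f (Iio 1) ∧ EqOn f (ordinaryHypergeometric a b c) (Ioo (-1) 1)

/-- The Gauss hypergeometric function `₂F₁(a, b; c; x)` for real `x < 1`: the analytic continuation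
to `(-∞, 1)` of the sum of the Gauss series. For `0 < b`, `0 < c` existence and uniqueness of the
continuation are proved below, see `gaussF_spec`, `gaussF_eq` and `gaussF_eq_series`. -/
noncomputable def gaussF (a b c x : ℝ) : ℝ :=
  Classical.epsilon (IsAnalyticContinuation a b c) x

/-- The `k`-th term (`k = 0, 1, 2, …`) of the series
`S(η, c; x) = ∑ k, ((1 - x) / (1 + η)) ^ k * ₂F₁(k/2 + 1/2, k/2 + 1; c; x)`. -/
noncomputable def term (η c x : ℝ) (k : ℕ) : ℝ :=
  ((1 - x) / (1 + η)) ^ k * gaussF ((k : ℝ) / 2 + 1 / 2) ((k : ℝ) / 2 + 1) c x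

/-! Existence and uniqueness of the analytic continuation. -/

theorem hyp_radius (a b c : ℝ) : 1 ≤ (ordinaryHypergeometricSeries ℝ a b c).radius := by
  by_cases h : ∀ k : ℕ, (k : ℝ) ≠ -a ∧ (k : ℝ) ≠ -b ∧ (k : ℝ) ≠ -c
  · exact (ordinaryHypergeometricSeries_radius_eq_one ℝ a b c h).ge
  · push Not at h
    obtain ⟨k, hk⟩ := h
    by_cases ha : (k : ℝ) = -a
    · rw [show a = -(k : ℝ) by linarith, ordinaryHypergeometric_radius_top_of_neg_nat₁]
      exact le_top
    by_cases hb : (k : ℝ) = -b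
    · rw [show b = -(k : ℝ) by linarith, ordinaryHypergeometric_radius_top_of_neg_nat₂]
      exact le_top
    · rw [show c = -(k : ℝ) by linarith [hk ha hb], ordinaryHypergeometric_radius_top_of_neg_nat₃]
      exact le_top

theorem hyp_hasFPowerSeries (a b c : ℝ) :
    HasFPowerSeriesOnBall (ordinaryHypergeometric a b c : ℝ → ℝ)
      (ordinaryHypergeometricSeries ℝ a b c) 0 1 :=
  ((ordinaryHypergeometricSeries ℝ a b c).hasFPowerSeriesOnBall
    (lt_of_lt_of_le one_pos (hyp_radius a b c))).mono one_pos (hyp_radius a b c)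

theorem mem_eball_one {x : ℝ} (hx : |x| < 1) : x ∈ Metric.eball (0 : ℝ) 1 := by
  rw [← ENNReal.ofReal_one, Metric.eball_ofReal]; simpa using hx

theorem hyp_summable (a b c : ℝ) {x : ℝ} (hx : |x| < 1) :
    Summable fun n => ‖ordinaryHypergeometricCoefficient a b c n * x ^ n‖ := by
  have h := (ordinaryHypergeometricSeries ℝ a b c).summable_norm_apply (x := x)
    (Metric.eball_subset_eball (hyp_radius a b c) (mem_eball_one hx))
  simp only [ordinaryHypergeometricSeries_apply_eq, smul_eq_mul] at h
  exact h

theorem vandermonde (n : ℕ) : ∀ e c : ℝ, 0 < c →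
    ∑ m ∈ Finset.range (n + 1), (-1 : ℝ) ^ m * n.choose m * (ascPochhammer ℝ m).eval e /
      (ascPochhammer ℝ m).eval c = (ascPochhammer ℝ n).eval (c - e) / (ascPochhammer ℝ n).eval c := by
  induction n with
  | zero => intro e c hc; simp
  | succ n ih =>
    intro e c hc
    have h1 : ∀ (t : ℝ) (m : ℕ), (ascPochhammer ℝ (m + 1)).eval t
        = t * (ascPochhammer ℝ m).eval (t + 1) := by
      intro t m; simp [ascPochhammer_succ_left]
    have hp := fun m => ascPochhammer_pos (S := ℝ) m c hc
    have hp1 := fun m => ascPochhammer_pos (S := ℝ) m (c + 1) (by linarith)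
    rw [Finset.sum_range_succ']
    have key : ∀ m, (-1 : ℝ) ^ (m + 1) * ((n + 1).choose (m + 1) : ℕ) *
        (ascPochhammer ℝ (m + 1)).eval e / (ascPochhammer ℝ (m + 1)).eval c
        = -(e / c) * ((-1 : ℝ) ^ m * n.choose m * (ascPochhammer ℝ m).eval (e + 1) /
          (ascPochhammer ℝ m).eval (c + 1)) + (-1 : ℝ) ^ (m + 1) * (n.choose (m + 1) : ℕ) *
        (ascPochhammer ℝ (m + 1)).eval e / (ascPochhammer ℝ (m + 1)).eval c := by
      intro m
      rw [Nat.choose_succ_succ, h1 e m, h1 c m]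
      have := (hp1 m).ne'
      field_simp
      push_cast
      ring
    rw [Finset.sum_congr rfl (fun m _ => key m), Finset.sum_add_distrib, ← Finset.mul_sum,
      ih (e + 1) (c + 1) (by linarith), add_assoc]
    have h2 := ih e c hc
    have h3 := Finset.sum_range_succ' (fun m => (-1 : ℝ) ^ m * (n.choose m : ℕ) *
        (ascPochhammer ℝ m).eval e / (ascPochhammer ℝ m).eval c) (n + 1)
    rw [Finset.sum_range_succ, h2] at h3
    simp only [Nat.choose_succ_self, Nat.choose_zero_right] at h3 ⊢
    rw [← h3, h1 c n, ascPochhammer_succ_eval n (c - e)]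
    have e2 := h1 c n
    rw [ascPochhammer_succ_eval n c] at e2
    have n1 := (hp n).ne'
    have n2 := (hp1 n).ne'
    rw [show c + 1 - (e + 1) = c - e by ring]
    simp only [Nat.cast_zero, mul_zero, zero_mul, zero_div, add_zero]
    field_simp
    linear_combination -(ascPochhammer ℝ n).eval (c - e) * e2

theorem binom_hasSum (s : ℝ) {x : ℝ} (hx : |x| < 1) :
    HasSum (fun j : ℕ => (ascPochhammer ℝ j).eval s / (j.factorial : ℝ) * x ^ j) ((1 - x) ^ (-s)) := by
  have h := (Real.one_div_one_sub_rpow_hasFPowerSeriesOnBall_zero s).hasSum (mem_eball_one hx)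
  have hpos : 0 ≤ 1 - x := by linarith [(abs_lt.1 hx).2]
  simp only [zero_add, one_div, ← Real.rpow_neg hpos] at h
  refine h.congr_fun ?_
  intro j
  rw [FormalMultilinearSeries.ofScalars_apply_eq, smul_eq_mul, ← Ring.multichoose_eq]
  have := Ring.factorial_nsmul_multichoose_eq_ascPochhammer s j
  rw [Polynomial.ascPochhammer_smeval_eq_eval] at this
  rw [← this, nsmul_eq_mul]
  have : (j.factorial : ℝ) ≠ 0 := by positivity
  field_simp

theorem poch_add (b : ℝ) (m j : ℕ) : (ascPochhammer ℝ (m + j)).eval b =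
    (ascPochhammer ℝ m).eval b * (ascPochhammer ℝ j).eval (b + m) := by
  rw [← ascPochhammer_mul]; simp

theorem pfaff_coeff (a b c : ℝ) (hc : 0 < c) (n : ℕ) :
    ∑ p ∈ Finset.HasAntidiagonal.antidiagonal n, ordinaryHypergeometricCoefficient (c - a) b c p.1 * (-1) ^ p.1 *
      ((ascPochhammer ℝ p.2).eval (b + p.1) / (p.2.factorial : ℝ)) =
    ordinaryHypergeometricCoefficient a b c n := by
  have hp := fun m => ascPochhammer_pos (S := ℝ) m c hc
  rw [Finset.Nat.sum_antidiagonal_eq_sum_range_succ_mk]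
  have hv := vandermonde n (c - a) c hc
  rw [sub_sub_cancel] at hv
  unfold ordinaryHypergeometricCoefficient
  rw [show ((n.factorial : ℝ)⁻¹ * (ascPochhammer ℝ n).eval a * (ascPochhammer ℝ n).eval b *
    ((ascPochhammer ℝ n).eval c)⁻¹) = ((n.factorial : ℝ)⁻¹ * (ascPochhammer ℝ n).eval b) *
    ((ascPochhammer ℝ n).eval a / (ascPochhammer ℝ n).eval c) by rw [div_eq_mul_inv]; ring, ← hv,
    Finset.mul_sum]
  refine Finset.sum_congr rfl fun m hm => ?_
  have hmn : m ≤ n := by simpa [Nat.lt_succ_iff] using hm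
  have h1 := poch_add b m (n - m)
  rw [Nat.add_sub_cancel' hmn] at h1
  rw [h1, Nat.cast_choose ℝ hmn]
  have f1 : (n.factorial : ℝ) ≠ 0 := by positivity
  have f2 : (m.factorial : ℝ) ≠ 0 := by positivity
  have f3 : ((n - m).factorial : ℝ) ≠ 0 := by positivity
  have := (hp m).ne'
  field_simp

theorem pfaff_near_zero (a b c : ℝ) (hb : 0 < b) (hc : 0 < c) {x : ℝ} (hx : |x| < 1 / 4) :
    (1 - x) ^ (-b) * ordinaryHypergeometric (c - a) b c (x / (x - 1)) =
      ordinaryHypergeometric a b c x := by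
  have hx1 : |x| < 1 := by linarith
  obtain ⟨hxl, hxu⟩ := abs_lt.1 hx
  have hpos : 0 < 1 - x := by linarith
  have hpos' : 0 < 1 - |x| := by linarith
  let A := ordinaryHypergeometricCoefficient (c - a) b c
  let B : ℕ → ℕ → ℝ := fun m j => (ascPochhammer ℝ j).eval (b + m) / (j.factorial : ℝ)
  have hB : ∀ m j, 0 ≤ B m j := fun m j => div_nonneg
    (ascPochhammer_pos (S := ℝ) j (b + m) (by positivity)).le (by positivity)
  let G : ℕ × ℕ → ℝ := fun p => (A p.1 * (-1) ^ p.1 * x ^ p.1) * (B p.1 p.2 * x ^ p.2)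
  have hGn : ∀ m j, ‖G (m, j)‖ = (|A m| * |x| ^ m) * (B m j * |x| ^ j) := by
    intro m j
    simp only [G, Real.norm_eq_abs, abs_mul, abs_pow, abs_neg, abs_one, one_pow, mul_one,
      abs_of_nonneg (hB m j)]
  have hq : |(|x| / (1 - |x|))| < 1 := by
    rw [abs_of_nonneg (by positivity), div_lt_one hpos']; linarith
  have hin : ∀ m, HasSum (fun j => ‖G (m, j)‖)
      (|A m| * |x| ^ m * (1 - |x|) ^ (-(b + m))) := by
    intro m
    simp only [hGn]
    exact (binom_hasSum (b + m) (x := |x|) (by rwa [abs_abs])).mul_left _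
  have hGs : Summable G := by
    refine Summable.of_norm ?_
    rw [summable_prod_of_nonneg (fun _ => norm_nonneg _)]
    refine ⟨fun m => (hin m).summable, ?_⟩
    simp only [(hin _).tsum_eq]
    refine ((hyp_summable (c - a) b c hq).mul_left ((1 - |x|) ^ (-b))).congr fun m => ?_
    rw [neg_add, Real.rpow_add hpos', Real.rpow_neg hpos'.le (m : ℝ), Real.rpow_natCast,
      norm_mul, norm_pow, Real.norm_eq_abs, Real.norm_eq_abs, abs_div, abs_abs,
      abs_of_pos hpos', div_pow]
    change _ * (|A m| * _) = _
    ring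
  have hL : ∑' p, G p = (1 - x) ^ (-b) * ordinaryHypergeometric (c - a) b c (x / (x - 1)) := by
    rw [hGs.tsum_prod, ordinaryHypergeometric_eq_tsum]
    simp only [smul_eq_mul]
    rw [← tsum_mul_left]
    refine tsum_congr fun m => ?_
    have := ((binom_hasSum (b + m) hx1).mul_left (A m * (-1) ^ m * x ^ m)).tsum_eq
    change ∑' j, (A m * (-1) ^ m * x ^ m) * (B m j * x ^ j) = _
    rw [this, neg_add, Real.rpow_add hpos, Real.rpow_neg hpos.le (m : ℝ), Real.rpow_natCast,
      show x / (x - 1) = -1 * x / (1 - x) by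
        rw [← neg_sub 1 x, div_neg, neg_one_mul, neg_div], div_pow, mul_pow]
    change _ = (1 - x) ^ (-b) * (A m * _)
    ring
  have hR : ∑' p, G p = ordinaryHypergeometric a b c x := by
    rw [← Finset.HasAntidiagonal.sigmaAntidiagonalEquivProd.tsum_eq G]
    have hs := Finset.HasAntidiagonal.sigmaAntidiagonalEquivProd.summable_iff.2 hGs
    simp only [Function.comp_def] at hs
    rw [Summable.tsum_sigma' (fun n => (hasSum_fintype _).summable) hs,
      ordinaryHypergeometric_eq_tsum]
    refine tsum_congr fun n => ?_
    rw [tsum_fintype, smul_eq_mul]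
    have := pfaff_coeff a b c hc n
    unfold ordinaryHypergeometricCoefficient at this
    rw [← this, Finset.sum_mul, ← Finset.sum_coe_sort (Finset.HasAntidiagonal.antidiagonal n)]
    refine Finset.sum_congr rfl fun p _ => ?_
    have hp := Finset.HasAntidiagonal.mem_antidiagonal.1 p.2
    have hxp : x ^ n = x ^ p.1.1 * x ^ p.1.2 := by rw [← pow_add, hp]
    rw [hxp]
    change (A p.1.1 * (-1) ^ p.1.1 * x ^ p.1.1) * (B p.1.1 p.1.2 * x ^ p.1.2) =
      A p.1.1 * (-1) ^ p.1.1 * B p.1.1 p.1.2 * _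
    ring
  rw [← hL, hR]

theorem hyp_analyticAt (a b c : ℝ) {x : ℝ} (hx : |x| < 1) :
    AnalyticAt ℝ (ordinaryHypergeometric a b c : ℝ → ℝ) x :=
  (hyp_hasFPowerSeries a b c).analyticAt_of_mem (mem_eball_one hx)

theorem exists_isAnalyticContinuation (a b c : ℝ) (hb : 0 < b) (hc : 0 < c) :
    ∃ f : ℝ → ℝ, IsAnalyticContinuation a b c f := by
  let g : ℝ → ℝ := fun x => (1 - x) ^ (-b) * ordinaryHypergeometric (c - a) b c (x / (x - 1))
  have hg : AnalyticOnNhd ℝ g (Iio (1 / 2)) := by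
    intro x hx
    have hx' : x < 1 / 2 := hx
    have hq : |x / (x - 1)| < 1 := by
      rw [abs_div, div_lt_one (abs_pos.2 (by linarith)), abs_of_neg (by linarith : x - 1 < 0),
        abs_lt]
      constructor <;> linarith
    refine AnalyticAt.mul ?_ ?_
    · have h1 : AnalyticAt ℝ (fun y : ℝ => Real.exp (Real.log (1 - y) * -b)) x :=
        (((analyticAt_const.sub analyticAt_id).log (by simp; linarith)).mul analyticAt_const).rexp
      refine h1.congr ?_
      filter_upwards [Iio_mem_nhds (show x < 1 by linarith)] with y hy
      rw [Real.rpow_def_of_pos (sub_pos.2 hy)]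
    · exact (hyp_analyticAt (c - a) b c hq).comp_of_eq
        (analyticAt_id.div (analyticAt_id.sub analyticAt_const) (by simp; linarith)) rfl
  have heq : EqOn g (ordinaryHypergeometric a b c) (Ioo (-1) (1 / 2)) := by
    refine (hg.mono fun x hx => hx.2).eqOn_of_preconnected_of_eventuallyEq
      (fun x hx => hyp_analyticAt a b c (abs_lt.2 ⟨hx.1, by linarith [hx.2]⟩))
      isPreconnected_Ioo (z₀ := 0) ⟨by norm_num, by norm_num⟩ ?_
    filter_upwards [Metric.ball_mem_nhds (0 : ℝ) (ε := 1 / 4) (by norm_num)] with x hx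
    exact pfaff_near_zero a b c hb hc (by simpa using hx)
  classical
  refine ⟨fun x => if x ≤ -1 / 2 then g x else ordinaryHypergeometric a b c x, ?_, ?_⟩
  · intro x hx
    have hx' : x < 1 := hx
    by_cases h : x < 0
    · refine (hg x (show x < 1 / 2 by linarith)).congr ?_
      filter_upwards [Iio_mem_nhds h] with y hy
      split_ifs with h2
      · rfl
      · exact heq ⟨by linarith, by linarith [show y < 0 from hy]⟩
    · refine (hyp_analyticAt a b c (abs_lt.2 ⟨by linarith, hx'⟩)).congr ?_
      filter_upwards [Ioi_mem_nhds (show -1 / 2 < x by linarith)] with y hy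
      rw [if_neg (not_le.2 hy)]
  · intro x hx
    dsimp only
    split_ifs with h
    · exact heq ⟨hx.1, by linarith⟩
    · rfl

theorem IsAnalyticContinuation.eqOn {a b c : ℝ} {f g : ℝ → ℝ}
    (hf : IsAnalyticContinuation a b c f)
    (hg : IsAnalyticContinuation a b c g) :
    EqOn f g (Iio 1) := by
  refine hf.1.eqOn_of_preconnected_of_eventuallyEq hg.1 isPreconnected_Iio (z₀ := 0)
    (by norm_num) ?_
  filter_upwards [Ioo_mem_nhds (show (-1 : ℝ) < 0 by norm_num) one_pos] with x hx
  rw [hf.2 hx, hg.2 hx]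

theorem gaussF_spec (a b c : ℝ) (hb : 0 < b) (hc : 0 < c) :
    IsAnalyticContinuation a b c (gaussF a b c) :=
  Classical.epsilon_spec (exists_isAnalyticContinuation a b c hb hc)

theorem gaussF_eq {a b c : ℝ} {f : ℝ → ℝ} (hf : IsAnalyticContinuation a b c f) {x : ℝ}
    (hx : x < 1) : gaussF a b c x = f x :=
  IsAnalyticContinuation.eqOn (Classical.epsilon_spec ⟨f, hf⟩) hf hx

theorem gaussF_eq_series (a b c : ℝ) {x : ℝ} (hb : 0 < b) (hc : 0 < c) (hx : |x| < 1) :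
    gaussF a b c x = ∑' n : ℕ, (ascPochhammer ℝ n).eval a * (ascPochhammer ℝ n).eval b /
      (ascPochhammer ℝ n).eval c * x ^ n / (n.factorial : ℝ) := by
  rw [(gaussF_spec a b c hb hc).2 (abs_lt.1 hx), ordinaryHypergeometric_eq_tsum]
  refine tsum_congr fun n => ?_
  rw [smul_eq_mul]
  ring

end

end GaussSum

namespace GaussSum

/-! ### Arguments in (0, 1): a nonnegative double series. -/

section PositiveArgument

/-! For `0 < x < 1` put `r = (1 - x)/(1 + η)` and expand every hypergeometric factor. All entries of
the double series in `(n, k)` are nonnegative, so it may be summed over `k` first. Since `(k/2 +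
1/2)_n (k/2 + 1)_n = (2n)! C(k + 2n, 2n) / 4^n`, each inner sum is a negative binomial series, and
what remains is `(1 - r)⁻¹ ∑ (1/2)_n / (c)_n (x/(1 - r)²)^n`. Its ratio is at most 1 exactly when `η
≥ √x`; at ratio 1 it converges because `c > 3/2` (`summable_poch_ratio`, `summable_pow_mul_gaussF`).

For `x < 0` put `x = -tan² θ` and `R = √(1 - x) = 1/cos θ`. The `k`-th term is `R⁻¹ (R/(1 + η))^k
y(θ)` with `y = R^(k+1) ₂F₁`, and the condition on `η` says that `R/(1 + η)` is at most 1, or less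
than 1 when `c ≤ 3/2`. So the growth of `y` in `k` decides. The hypergeometric equation becomes a
Gegenbauer equation for `y` (`exists_angular_solution`), to which energy estimates apply. A monotone
energy bounds `|y|` by 1 for `c ≥ 1/2` and large `k`; a contiguous relation turns this into a
quadratic bound in `k` for every `c > 0`, enough against a geometric factor. For `c > 3/2` a
weighted energy gives `y = O(k^(-(c - 1/2)))`, which is summable by itself because `c - 1/2 > 1`. -/

theorem poch_half_mul_poch_half (k n : ℕ) :
    (ascPochhammer ℝ n).eval ((k : ℝ) / 2 + 1 / 2) * (ascPochhammer ℝ n).eval ((k : ℝ) / 2 + 1) =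
      (2 * n).factorial * (k + 2 * n).choose (2 * n) / 4 ^ n := by
  have key : (ascPochhammer ℝ n).eval ((k : ℝ) / 2 + 1 / 2) *
      (ascPochhammer ℝ n).eval ((k : ℝ) / 2 + 1) * 4 ^ n * k.factorial =
        (k + 2 * n).factorial := by
    induction n with
    | zero => simp
    | succ n ih =>
      rw [show k + 2 * (n + 1) = k + 2 * n + 1 + 1 by ring, Nat.factorial_succ, Nat.factorial_succ]
      push_cast
      rw [← ih, ascPochhammer_succ_eval, ascPochhammer_succ_eval]
      ring
  have hch : ((k + 2 * n).choose (2 * n) : ℝ) * (2 * n).factorial * k.factorial =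
      (k + 2 * n).factorial := by
    have h := Nat.choose_mul_factorial_mul_factorial (Nat.le_add_left (2 * n) k)
    rw [Nat.add_sub_cancel] at h
    exact_mod_cast h
  have hk : (k.factorial : ℝ) ≠ 0 := by positivity
  rw [eq_div_iff (by positivity)]
  apply mul_right_cancel₀ hk
  rw [key, ← hch]
  ring

/-- For `y < 1` this is the Gauss series of `₂F₁(1/2, 1; c; y)`. At `y = 1` the recurrence of the
coefficients makes the partial sums telescope, and `c > 3/2` bounds them. -/
theorem summable_poch_ratio {c y : ℝ} (hc : 0 < c) (hy : 0 ≤ y)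
    (h : y < 1 ∨ (y ≤ 1 ∧ 3 / 2 < c)) :
    Summable fun n : ℕ =>
      (ascPochhammer ℝ n).eval (1 / 2 : ℝ) / (ascPochhammer ℝ n).eval c * y ^ n := by
  have hpc := fun n => ascPochhammer_pos (S := ℝ) n c hc
  have hph := fun n => ascPochhammer_pos (S := ℝ) n (1 / 2) (by norm_num)
  rcases h with h | ⟨h, hc'⟩
  · refine (hyp_summable (1 / 2) 1 c (abs_lt.2 ⟨by linarith, h⟩)).of_norm.congr fun n => ?_
    rw [ordinaryHypergeometricCoefficient, ascPochhammer_eval_one]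
    have : (n.factorial : ℝ) ≠ 0 := by positivity
    field_simp
  · let w : ℕ → ℝ := fun n => (ascPochhammer ℝ n).eval (1 / 2 : ℝ) / (ascPochhammer ℝ n).eval c
    have hw : ∀ n, 0 < w n := fun n => div_pos (hph n) (hpc n)
    have hstep : ∀ n : ℕ, (n + c) * w (n + 1) = (n + 1 / 2) * w n := by
      intro n
      have h1 := (hpc n).ne'
      have h2 : c + n ≠ 0 := by positivity
      simp only [w, ascPochhammer_succ_eval]
      field_simp
      ring
    have hsum : ∀ n : ℕ, (c - 3 / 2) * ∑ i ∈ Finset.range n, w i =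
        (c - 1) - (n + c - 1) * w n := by
      intro n
      induction n with
      | zero => simp [w]
      | succ n ih =>
        rw [Finset.sum_range_succ, mul_add, ih]
        push_cast
        linear_combination hstep n
    have hws : Summable w := by
      refine summable_of_sum_range_le (c := (c - 1) / (c - 3 / 2)) (fun n => (hw n).le) fun n => ?_
      rw [le_div_iff₀ (by linarith), mul_comm, hsum]
      have : 0 ≤ (n + c - 1) * w n :=
        mul_nonneg (by have : (0 : ℝ) ≤ n := n.cast_nonneg
                       linarith) (hw n).le
      linarith
    refine Summable.of_nonneg_of_le (fun n => by have := hw n; positivity) (fun n => ?_) hws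
    exact mul_le_of_le_one_right (hw n).le (pow_le_one₀ hy h)

theorem summable_pow_mul_gaussF {c x r : ℝ} (hc : 0 < c) (hx0 : 0 < x) (hx1 : x < 1)
    (hr0 : 0 < r) (hr1 : r < 1) (h : x < (1 - r) ^ 2 ∨ (x ≤ (1 - r) ^ 2 ∧ 3 / 2 < c)) :
    Summable fun k : ℕ => r ^ k * gaussF ((k : ℝ) / 2 + 1 / 2) ((k : ℝ) / 2 + 1) c x := by
  have hpc := fun n => ascPochhammer_pos (S := ℝ) n c hc
  have hq : 0 < (1 - r) ^ 2 := by have : 0 < 1 - r := by linarith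
                                  positivity
  have hr : ‖r‖ < 1 := by rwa [Real.norm_of_nonneg hr0.le]
  let A : ℕ → ℝ := fun n => (2 * n).factorial / 4 ^ n / (ascPochhammer ℝ n).eval c *
    x ^ n / n.factorial
  have hA : ∀ n, 0 ≤ A n := fun n => by have := hpc n; positivity
  let G : ℕ × ℕ → ℝ := fun p => A p.1 * ((p.2 + 2 * p.1).choose (2 * p.1) * r ^ p.2)
  have hin : ∀ n, HasSum (fun k => G (n, k)) (A n * (1 / (1 - r) ^ (2 * n + 1))) := fun n =>
    (hasSum_choose_mul_geometric_of_norm_lt_one (2 * n) hr).mul_left (A n)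
  have hG : Summable G := by
    rw [summable_prod_of_nonneg fun p => mul_nonneg (hA _) (by positivity)]
    refine ⟨fun n => (hin n).summable, ?_⟩
    have hy : x / (1 - r) ^ 2 < 1 ∨ (x / (1 - r) ^ 2 ≤ 1 ∧ 3 / 2 < c) := by
      rwa [div_lt_one hq, div_le_one hq]
    refine ((summable_poch_ratio hc (by positivity) hy).mul_left (1 - r)⁻¹).congr fun n => ?_
    -- The case `k = 0` reads `(1/2)_n n! = (2n)!/4^n`.
    have h0 := poch_half_mul_poch_half 0 n
    simp only [Nat.cast_zero, zero_div, zero_add, ascPochhammer_eval_one, Nat.choose_self,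
      Nat.cast_one, mul_one] at h0
    have : (n.factorial : ℝ) ≠ 0 := by positivity
    have h1 : (1 - r) ≠ 0 := by linarith
    rw [(hin n).tsum_eq]
    simp only [A]
    rw [← h0, div_pow, ← pow_mul, pow_succ]
    field_simp
  -- Fubini: summing over `n` first recovers the series in `k`.
  refine hG.prod_symm.prod.congr fun k => ?_
  rw [gaussF_eq_series _ _ _ (by positivity) hc (abs_lt.2 ⟨by linarith, hx1⟩), ← tsum_mul_left]
  refine tsum_congr fun n => ?_
  simp only [G, A, Prod.swap]
  rw [poch_half_mul_poch_half]
  ring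

theorem summable_term_of_pos {η c x : ℝ} (hx0 : 0 < x) (hx1 : x < 1)
    (h : (0 < c ∧ c ≤ 3 / 2 ∧ η > √x) ∨ (c > 3 / 2 ∧ η ≥ √x)) :
    Summable fun k : ℕ => |term η c x k| := by
  have hs : 0 < √x := Real.sqrt_pos.2 hx0
  have hs1 : √x < 1 := by rw [Real.sqrt_lt' one_pos]; simpa using hx1
  have hsq : √x ^ 2 = x := Real.sq_sqrt hx0.le
  have hη : √x ≤ η := by rcases h with h | h <;> linarith [h.2]
  have hr0 : 0 < (1 - x) / (1 + η) := div_pos (by linarith) (by linarith)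
  -- After clearing `1 + η` this is `(1 - √x)(η - √x) ≥ 0`.
  have hr : √x ≤ 1 - (1 - x) / (1 + η) := by
    rw [le_sub_comm, div_le_iff₀ (by linarith)]
    nlinarith
  refine Summable.abs (summable_pow_mul_gaussF ?_ hx0 hx1 hr0 (by linarith) ?_)
  · rcases h with h | h <;> linarith [h.1]
  · rcases h with ⟨-, -, h⟩ | ⟨hc, -⟩
    · left
      have : √x < 1 - (1 - x) / (1 + η) := by
        rw [lt_sub_comm, div_lt_iff₀ (by linarith)]
        nlinarith
      nlinarith
    · right
      exact ⟨by nlinarith, hc⟩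

end PositiveArgument

end GaussSum

namespace GaussSum

/-! ### The hypergeometric equation and a contiguous relation on (-∞, 1). -/

section DifferentialEquation

open Set Filter Topology

theorem hasSum_coeff_mul_pow {f : ℝ → ℝ} {p : FormalMultilinearSeries ℝ ℝ ℝ}
    (h : HasFPowerSeriesOnBall f p 0 1) {x : ℝ} (hx : |x| < 1) :
    HasSum (fun n => p.coeff n * x ^ n) (f x) := by
  have h1 := h.hasSum (mem_eball_one hx)
  simp only [zero_add, FormalMultilinearSeries.apply_eq_pow_smul_coeff, smul_eq_mul] at h1
  simpa only [mul_comm] using h1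

theorem hasFPowerSeriesOnBall_deriv {f : ℝ → ℝ} {p : FormalMultilinearSeries ℝ ℝ ℝ}
    (h : HasFPowerSeriesOnBall f p 0 1) :
    ∃ q : FormalMultilinearSeries ℝ ℝ ℝ, HasFPowerSeriesOnBall (deriv f) q 0 1 ∧
      ∀ n, q.coeff n = (n + 1) * p.coeff (n + 1) := by
  refine ⟨_, (ContinuousLinearMap.apply ℝ ℝ (1 : ℝ)).comp_hasFPowerSeriesOnBall h.fderiv,
    fun n => ?_⟩
  have := p.derivSeries_coeff_one n
  rw [nsmul_eq_mul] at this
  push_cast at this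
  exact this

theorem hasSum_mul_of_hasSum_succ {u : ℕ → ℝ} {x s : ℝ}
    (h : HasSum (fun n : ℕ => (n + 1 : ℝ) * u (n + 1) * x ^ n) s) :
    HasSum (fun n : ℕ => (n : ℝ) * u n * x ^ n) (x * s) := by
  rw [← hasSum_nat_add_iff' 1]
  simpa [pow_succ, mul_assoc, mul_comm, mul_left_comm] using h.mul_left x

theorem hyp_hasSum (a b c : ℝ) {x : ℝ} (hx : |x| < 1) :
    HasSum (fun n => ordinaryHypergeometricCoefficient a b c n * x ^ n)
      (ordinaryHypergeometric a b c x) := by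
  simpa [ordinaryHypergeometricSeries, FormalMultilinearSeries.coeff_ofScalars] using
    hasSum_coeff_mul_pow (hyp_hasFPowerSeries a b c) hx

theorem hypCoeff_succ (a b : ℝ) {c : ℝ} (hc : 0 < c) (n : ℕ) :
    (n + 1) * (n + c) * ordinaryHypergeometricCoefficient a b c (n + 1) =
      (n + a) * (n + b) * ordinaryHypergeometricCoefficient a b c n := by
  have h1 := (ascPochhammer_pos (S := ℝ) n c hc).ne'
  have h2 : c + n ≠ 0 := by positivity
  have h3 : (n.factorial : ℝ) ≠ 0 := by positivity
  simp only [ordinaryHypergeometricCoefficient, ascPochhammer_succ_eval, Nat.factorial_succ]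
  push_cast
  field_simp
  ring

theorem hyp_differential_equation (a b : ℝ) {c x : ℝ} (hc : 0 < c) (hx : |x| < 1) :
    x * (1 - x) * deriv (deriv (ordinaryHypergeometric a b c)) x +
      (c - (a + b + 1) * x) * deriv (ordinaryHypergeometric a b c) x -
        a * b * ordinaryHypergeometric a b c x = 0 := by
  have h0 := hyp_hasFPowerSeries a b c
  obtain ⟨p1, h1, hp1⟩ := hasFPowerSeriesOnBall_deriv h0
  obtain ⟨p2, h2, hp2⟩ := hasFPowerSeriesOnBall_deriv h1
  let q := ordinaryHypergeometricCoefficient a b c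
  have e1 : ∀ n : ℕ, p1.coeff n = (n + 1) * q (n + 1) := fun n => by
    rw [hp1]
    simp [ordinaryHypergeometricSeries, FormalMultilinearSeries.coeff_ofScalars, q]
  have s0 := hyp_hasSum a b c hx
  have s1 := hasSum_coeff_mul_pow h1 hx
  have s2 := hasSum_coeff_mul_pow h2 hx
  simp only [hp2] at s2
  have s2' := hasSum_mul_of_hasSum_succ (u := fun n => p1.coeff n) s2
  -- This is the expansion of `x² f''`, with coefficients `n (n - 1) q n`.
  have s2'' := hasSum_mul_of_hasSum_succ (u := fun n => ((n : ℝ) - 1) * q n) (s2'.congr_fun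
    fun n => by rw [e1]; push_cast; ring)
  have s1' := hasSum_mul_of_hasSum_succ (u := q) (s1.congr_fun fun n => by rw [e1])
  have := (((s2'.sub s2'').add (s1.mul_left c)).sub (s1'.mul_left (a + b + 1))).sub
    (s0.mul_left (a * b))
  have hz := this.congr_fun (g := fun _ => 0) fun n => by
    rw [e1]
    have := hypCoeff_succ a b hc n
    linear_combination (-x ^ n) * this
  have := hz.unique hasSum_zero
  linear_combination this

theorem gaussF_eventuallyEq (a : ℝ) {b c : ℝ} (hb : 0 < b) (hc : 0 < c) {x : ℝ} (hx : |x| < 1) :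
    gaussF a b c =ᶠ[𝓝 x] ordinaryHypergeometric a b c :=
  (gaussF_spec a b c hb hc).2.eventuallyEq_of_mem (Ioo_mem_nhds (abs_lt.1 hx).1 (abs_lt.1 hx).2)

/-- The left side is analytic on `(-∞, 1)` and vanishes on `(-1, 1)` by the power series, so the
identity theorem applies. -/
theorem gaussF_differential_equation (a : ℝ) {b c x : ℝ} (hb : 0 < b) (hc : 0 < c) (hx : x < 1) :
    x * (1 - x) * deriv (deriv (gaussF a b c)) x +
      (c - (a + b + 1) * x) * deriv (gaussF a b c) x - a * b * gaussF a b c x = 0 := by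
  have hF := (gaussF_spec a b c hb hc).1
  have hid : AnalyticOnNhd ℝ (fun x : ℝ => x) (Iio 1) := fun _ _ => analyticAt_id
  have hk : ∀ r : ℝ, AnalyticOnNhd ℝ (fun _ : ℝ => r) (Iio 1) := fun r _ _ => analyticAt_const
  have hL : AnalyticOnNhd ℝ (fun x => x * (1 - x) * deriv (deriv (gaussF a b c)) x +
      (c - (a + b + 1) * x) * deriv (gaussF a b c) x - a * b * gaussF a b c x) (Iio 1) :=
    (((hid.mul ((hk 1).sub hid)).mul hF.deriv.deriv).add
      (((hk c).sub ((hk _).mul hid)).mul hF.deriv)).sub ((hk _).mul hF)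
  refine hL.eqOn_of_preconnected_of_eventuallyEq (hk 0) isPreconnected_Iio (z₀ := 0)
    (by norm_num) ?_ hx
  filter_upwards [Ioo_mem_nhds (show (-1 : ℝ) < 0 by norm_num) one_pos] with y hy
  have h := gaussF_eventuallyEq a hb hc (abs_lt.2 hy)
  rw [h.deriv.deriv_eq, h.deriv_eq, h.eq_of_nhds, hyp_differential_equation a b hc (abs_lt.2 hy)]

/-- Coefficientwise this is `1/(c)_n = (1 + n/c)/(c + 1)_n`, continued analytically. It raises the
third parameter above 1/2, where the energy argument works. -/
theorem gaussF_eq_add_gaussF_succ (a : ℝ) {b c x : ℝ} (hb : 0 < b) (hc : 0 < c) (hx : x < 1) :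
    gaussF a b c x = gaussF a b (c + 1) x +
      x * (a * b / (c * (c + 1)) * gaussF (a + 1) (b + 1) (c + 2) x) := by
  have hF1 := gaussF_spec a b (c + 1) hb (by linarith)
  have hF2 := gaussF_spec (a + 1) (b + 1) (c + 2) (by linarith) (by linarith)
  refine gaussF_eq (f := fun x => gaussF a b (c + 1) x +
      x * (a * b / (c * (c + 1)) * gaussF (a + 1) (b + 1) (c + 2) x)) ⟨?_, ?_⟩ hx
  · exact fun y hy => (hF1.1 y hy).add (analyticAt_id.mul (analyticAt_const.mul (hF2.1 y hy)))
  · intro y hy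
    have hy' := abs_lt.2 hy
    dsimp only
    rw [hF1.2 hy, hF2.2 hy]
    have h1 : ∀ (t : ℝ) (m : ℕ), (ascPochhammer ℝ (m + 1)).eval t
        = t * (ascPochhammer ℝ m).eval (t + 1) := fun t m => by simp [ascPochhammer_succ_left]
    let q := ordinaryHypergeometricCoefficient a b (c + 1)
    have s2 := hasSum_mul_of_hasSum_succ (u := fun n => q n / c)
      (((hyp_hasSum (a + 1) (b + 1) (c + 2) hy').mul_left (a * b / (c * (c + 1)))).congr_fun
      fun n => by
        have p1 := (ascPochhammer_pos (S := ℝ) n (c + 2) (by linarith)).ne'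
        have h3 : (n.factorial : ℝ) ≠ 0 := by positivity
        simp only [q, ordinaryHypergeometricCoefficient, h1, Nat.factorial_succ]
        rw [show c + 1 + 1 = c + 2 by ring]
        push_cast
        field_simp)
    refine (((hyp_hasSum a b (c + 1) hy').add s2).congr_fun fun n => ?_).unique
      (hyp_hasSum a b c hy')
    have p1 := (ascPochhammer_pos (S := ℝ) n c hc).ne'
    have p2 := (ascPochhammer_pos (S := ℝ) n (c + 1) (by linarith)).ne'
    have hcn := h1 c n
    rw [ascPochhammer_succ_eval] at hcn
    simp only [q, ordinaryHypergeometricCoefficient]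
    field_simp
    linear_combination (-(ascPochhammer ℝ n).eval a * (ascPochhammer ℝ n).eval b * y ^ n) * hcn

end DifferentialEquation

end GaussSum

namespace GaussSum

/-! ### Energy estimates for the Gegenbauer equation. -/

section Energy

open Set Filter Topology Real

/-- In the angle `θ` with `x = -tan² θ`, the function `₂F₁(m/2, m/2 + 1/2; c; x) / cos ^ m θ` for
`m = k + 1` solves a Gegenbauer equation. -/
theorem exists_angular_solution (k : ℕ) {c : ℝ} (hc : 0 < c) :
    ∃ y y' z : ℝ → ℝ, y 0 = 1 ∧ y' 0 = 0 ∧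
      (∀ θ, y θ = (cos θ)⁻¹ ^ (k + 1) *
        gaussF ((k : ℝ) / 2 + 1 / 2) ((k : ℝ) / 2 + 1) c (1 - (cos θ)⁻¹ ^ 2)) ∧
      ∀ θ, 0 < cos θ → HasDerivAt y (y' θ) θ ∧ HasDerivAt y' (z θ) θ ∧
        sin θ * z θ + (2 * c - 1) * cos θ * y' θ +
          ((k : ℝ) + 1) * (k + 2 - 2 * c) * sin θ * y θ = 0 := by
  set a : ℝ := (k : ℝ) / 2 + 1 / 2 with ha
  set b : ℝ := (k : ℝ) / 2 + 1 with hb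
  have hb0 : 0 < b := by positivity
  have hF := gaussF_spec a b c hb0 hc
  set F := gaussF a b c with hFdef
  have hF0 : F 0 = 1 := by
    rw [hF.2 ⟨by norm_num, by norm_num⟩, ordinaryHypergeometric_zero]
  let D : ℝ → ℝ := fun θ => (cos θ)⁻¹
  let X : ℝ → ℝ := fun θ => 1 - D θ ^ 2
  let F1 := deriv F
  let F2 := deriv F1
  refine ⟨fun θ => D θ ^ (k + 1) * F (X θ),
    fun θ => sin θ * ((k + 1) * (D θ ^ (k + 2) * F (X θ)) - 2 * (D θ ^ (k + 4) * F1 (X θ))),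
    fun θ => cos θ * ((k + 1) * (D θ ^ (k + 2) * F (X θ)) - 2 * (D θ ^ (k + 4) * F1 (X θ))) +
      sin θ * ((k + 1) * ((k + 2) * D θ ^ (k + 1) * (sin θ * D θ ^ 2) * F (X θ) +
        D θ ^ (k + 2) * (F1 (X θ) * (-2 * sin θ * D θ ^ 3))) -
        2 * ((k + 4) * D θ ^ (k + 3) * (sin θ * D θ ^ 2) * F1 (X θ) +
        D θ ^ (k + 4) * (F2 (X θ) * (-2 * sin θ * D θ ^ 3)))), ?_, by simp, fun θ => rfl, ?_⟩
  · simp [D, X, hF0]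
  intro θ hθ
  have hDpos : 0 < D θ := inv_pos.2 hθ
  have hX : X θ < 1 := by simp only [X]; nlinarith
  have hD : HasDerivAt D (sin θ * D θ ^ 2) θ := by
    refine HasDerivAt.congr_deriv ((hasDerivAt_cos θ).fun_inv hθ.ne') ?_
    simp only [D]
    field_simp
  have hXd : HasDerivAt X (-2 * sin θ * D θ ^ 3) θ := by
    refine HasDerivAt.congr_deriv ((hD.fun_pow 2).const_sub 1) ?_
    ring
  have hd0 : HasDerivAt (fun θ => F (X θ)) (F1 (X θ) * (-2 * sin θ * D θ ^ 3)) θ :=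
    (hF.1 (X θ) hX).differentiableAt.hasDerivAt.comp θ hXd
  have hd1 : HasDerivAt (fun θ => F1 (X θ)) (F2 (X θ) * (-2 * sin θ * D θ ^ 3)) θ :=
    (hF.1.deriv (X θ) hX).differentiableAt.hasDerivAt.comp θ hXd
  have hpow : ∀ n : ℕ, HasDerivAt (fun θ => D θ ^ (n + 1))
      ((n + 1) * D θ ^ n * (sin θ * D θ ^ 2)) θ := fun n => by
    simpa using hD.fun_pow (n + 1)
  refine ⟨?_, ?_, ?_⟩
  · refine HasDerivAt.congr_deriv ((hpow k).fun_mul hd0) ?_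
    ring
  · refine HasDerivAt.congr_deriv ((hasDerivAt_sin θ).fun_mul ((((hpow (k + 1)).fun_mul hd0).const_mul ((k : ℝ) + 1)).fun_sub
      (((hpow (k + 3)).fun_mul hd1).const_mul 2))) ?_
    push_cast
    ring
  · have hode := gaussF_differential_equation a hb0 hc hX
    have hCD : cos θ * D θ = 1 := mul_inv_cancel₀ hθ.ne'
    have hSD : sin θ ^ 2 * D θ ^ 2 = D θ ^ 2 - 1 := by
      rw [sin_sq]
      linear_combination (-(cos θ * D θ) - 1) * hCD
    change X θ * (1 - X θ) * F2 (X θ) + (c - (a + b + 1) * X θ) * F1 (X θ) - a * b * F (X θ) = 0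
      at hode
    simp only [X, ha, hb] at hode ⊢
    generalize F (1 - D θ ^ 2) = f at *
    generalize F1 (1 - D θ ^ 2) = f1 at *
    generalize F2 (1 - D θ ^ 2) = f2 at *
    generalize D θ = d at *
    generalize sin θ = s at *
    generalize cos θ = C at *
    -- The Gegenbauer equation is `-4 sin θ D^(k+3)` times the hypergeometric one, modulo `cos θ D =
    -- 1` and `sin² θ D² = D² - 1`.
    linear_combination (-4 * s * d ^ (k + 3)) * hode +
      s * (((k : ℝ) + 1) * (k + 2) * d ^ (k + 1) * f - 2 * (k + 1) * d ^ (k + 3) * f1 -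
        2 * (k + 4) * d ^ (k + 3) * f1 + 4 * d ^ (k + 5) * f2) * hSD +
      2 * c * s * ((k + 1) * d ^ (k + 1) * f - 2 * d ^ (k + 3) * f1) * hCD

/-- The first-order term is a damping: the derivative of the energy is `-2κ cot θ y'² ≤ 0`, and the
energy at 0 is `N`. -/
theorem energy_le {κ N : ℝ} {y y' z : ℝ → ℝ} (hκ : 0 ≤ κ) (h0 : y 0 = 1) (h0' : y' 0 = 0)
    (hd : ∀ θ, 0 < cos θ → HasDerivAt y (y' θ) θ ∧ HasDerivAt y' (z θ) θ ∧
      sin θ * z θ + κ * cos θ * y' θ + N * sin θ * y θ = 0) {θ : ℝ} (hθ0 : 0 ≤ θ)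
    (hθ : θ < π / 2) : N * y θ ^ 2 + y' θ ^ 2 ≤ N := by
  have hcos : ∀ t ∈ Icc 0 θ, 0 < cos t := fun t ht =>
    cos_pos_of_mem_Ioo ⟨by linarith [ht.1, pi_pos], ht.2.trans_lt hθ⟩
  have hE : ∀ t ∈ Icc 0 θ, HasDerivAt (fun t => N * y t ^ 2 + y' t ^ 2)
      (2 * y' t * (N * y t + z t)) t := fun t ht => by
    obtain ⟨h1, h2, -⟩ := hd t (hcos t ht)
    refine HasDerivAt.congr_deriv (((h1.fun_pow 2).const_mul N).fun_add (h2.fun_pow 2)) ?_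
    ring
  have hanti : AntitoneOn (fun t => N * y t ^ 2 + y' t ^ 2) (Icc 0 θ) := by
    refine antitoneOn_of_deriv_nonpos (convex_Icc _ _)
      (fun t ht => (hE t ht).continuousAt.continuousWithinAt)
      (fun t ht => (hE t (interior_subset ht)).differentiableAt.differentiableWithinAt)
      fun t ht => ?_
    rw [(hE t (interior_subset ht)).deriv]
    rw [interior_Icc] at ht
    have hc := hcos t (Ioo_subset_Icc_self ht)
    have hs : 0 < sin t := sin_pos_of_pos_of_lt_pi ht.1 (by linarith [ht.2, pi_pos])
    obtain ⟨-, -, h3⟩ := hd t hc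
    refine nonpos_of_mul_nonpos_right (a := sin t) ?_ hs
    have : sin t * (2 * y' t * (N * y t + z t)) = -(2 * κ * cos t * y' t ^ 2) := by
      linear_combination 2 * y' t * h3
    rw [this]
    have := mul_nonneg (mul_nonneg hκ hc.le) (sq_nonneg (y' t))
    linarith
  have := hanti (left_mem_Icc.2 hθ0) (right_mem_Icc.2 hθ0) hθ0
  simpa [h0, h0'] using this

/-- With `u = sin^l θ · y` the equation is `u'' + (ν² - l(l - 1)/sin² θ) u = 0`. The energy `ν²u² +
u'²` has derivative `2 l(l - 1) u u'/sin² θ`, at most `l(l - 1)/(ν sin² θ)` times the energy; the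
exponential of the cotangent is the matching integrating factor. -/
theorem weighted_energy_antitoneOn {l ν θ₁ θ₀ : ℝ} {y y' z : ℝ → ℝ} (hl : 1 ≤ l) (hν : 0 < ν)
    (hd : ∀ θ, 0 < cos θ → HasDerivAt y (y' θ) θ ∧ HasDerivAt y' (z θ) θ ∧
      sin θ * z θ + 2 * l * cos θ * y' θ + (ν ^ 2 - l ^ 2) * sin θ * y θ = 0)
    (h1 : 0 < θ₁) (h0 : θ₀ < π / 2) :
    AntitoneOn (fun θ => sin θ ^ (2 * l) * exp (l * (l - 1) / ν * (cos θ / sin θ)) *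
      (ν ^ 2 * y θ ^ 2 + (l * (cos θ / sin θ) * y θ + y' θ) ^ 2)) (Icc θ₁ θ₀) := by
  have hcos : ∀ t ∈ Icc θ₁ θ₀, 0 < cos t := fun t ht =>
    cos_pos_of_mem_Ioo ⟨by linarith [ht.1, pi_pos], ht.2.trans_lt h0⟩
  have hsin : ∀ t ∈ Icc θ₁ θ₀, 0 < sin t := fun t ht =>
    sin_pos_of_pos_of_lt_pi (h1.trans_le ht.1) (by linarith [ht.2, pi_pos])
  have hH : ∀ t ∈ Icc θ₁ θ₀, HasDerivAt
      (fun θ => sin θ ^ (2 * l) * exp (l * (l - 1) / ν * (cos θ / sin θ)) *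
        (ν ^ 2 * y θ ^ 2 + (l * (cos θ / sin θ) * y θ + y' θ) ^ 2))
      (-(sin t ^ (2 * l) * exp (l * (l - 1) / ν * (cos t / sin t)) *
        (l * (l - 1) / (sin t ^ 2 * ν) *
          (ν * y t - (l * (cos t / sin t) * y t + y' t)) ^ 2))) t := fun t ht => by
    have hs := hsin t ht
    obtain ⟨d1, d2, h3⟩ := hd t (hcos t ht)
    have hcot : HasDerivAt (fun θ => cos θ / sin θ) (-(1 / sin t ^ 2)) t := by
      refine HasDerivAt.congr_deriv ((hasDerivAt_cos t).fun_div (hasDerivAt_sin t) hs.ne') ?_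
      field_simp
      linear_combination -(sin_sq_add_cos_sq t)
    have hz : z t = -(2 * l * (cos t / sin t) * y' t) - (ν ^ 2 - l ^ 2) * y t := by
      field_simp
      linear_combination h3
    have hq : (cos t / sin t) ^ 2 = 1 / sin t ^ 2 - 1 := by
      field_simp
      linear_combination sin_sq_add_cos_sq t
    have hq' : sin t ^ (2 * l - 1) * cos t = sin t ^ (2 * l) * (cos t / sin t) := by
      rw [rpow_sub_one hs.ne']
      ring
    refine HasDerivAt.congr_deriv ((((hasDerivAt_sin t).rpow_const (p := 2 * l) (Or.inl hs.ne')).fun_mul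
      (hcot.const_mul (l * (l - 1) / ν)).exp).fun_mul (((d1.fun_pow 2).const_mul (ν ^ 2)).fun_add
      ((((hcot.const_mul l).fun_mul d1).fun_add d2).fun_pow 2))) ?_
    rw [hz, show cos t * (2 * l) * sin t ^ (2 * l - 1) =
      2 * l * (sin t ^ (2 * l) * (cos t / sin t)) by rw [← hq']; ring]
    have hi : 1 / sin t ^ 2 = (cos t / sin t) ^ 2 + 1 := by rw [hq]; ring
    rw [show l * (l - 1) / (sin t ^ 2 * ν) = l * (l - 1) / ν * (1 / sin t ^ 2) by
      field_simp, hi]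
    generalize cos t / sin t = q
    generalize exp (l * (l - 1) / ν * q) = e
    generalize sin t ^ (2 * l) = w
    field_simp
    ring
  refine antitoneOn_of_deriv_nonpos (convex_Icc _ _)
      (fun t ht => (hH t ht).continuousAt.continuousWithinAt)
      (fun t ht => (hH t (interior_subset ht)).differentiableAt.differentiableWithinAt)
      fun t ht => ?_
  rw [(hH t (interior_subset ht)).deriv]
  have hs := hsin t (interior_subset ht)
  have hl' : 0 ≤ l - 1 := by linarith
  exact neg_nonpos.2 (by positivity)

/-- The weighted energy is compared at `θ₀` and at `1/ν`. At `1/ν` the plain energy gives `|y| ≤ 1`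
and `|y'| ≤ ν`, while `cot(1/ν) ≤ ν` keeps the exponential bounded and `sin^(2l)(1/ν) ≤ ν^(-2l)`
supplies the decay. -/
theorem sq_le_of_weighted_energy {l ν θ₀ : ℝ} {y y' z : ℝ → ℝ} (hl : 1 ≤ l) (hν : l < ν)
    (hy0 : y 0 = 1) (hy0' : y' 0 = 0)
    (hd : ∀ θ, 0 < cos θ → HasDerivAt y (y' θ) θ ∧ HasDerivAt y' (z θ) θ ∧
      sin θ * z θ + 2 * l * cos θ * y' θ + (ν ^ 2 - l ^ 2) * sin θ * y θ = 0)
    (h1 : ν⁻¹ ≤ θ₀) (h0 : θ₀ < π / 2) :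
    y θ₀ ^ 2 ≤ exp (l * (l - 1)) * (1 + (l + 1) ^ 2) / sin θ₀ ^ (2 * l) * (ν ^ (-l)) ^ 2 := by
  have hν0 : 0 < ν := by linarith
  have hθ1 : 0 < ν⁻¹ := inv_pos.2 hν0
  have hN : 0 < ν ^ 2 - l ^ 2 := by nlinarith
  have hl' : 0 ≤ l - 1 := by linarith
  have hH := weighted_energy_antitoneOn hl hν0 hd hθ1 h0 (left_mem_Icc.2 h1) (right_mem_Icc.2 h1) h1
  have hE := energy_le (by linarith) hy0 hy0' hd hθ1.le (h1.trans_lt h0)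
  have hs0 : 0 < sin θ₀ := sin_pos_of_pos_of_lt_pi (by linarith) (by linarith [pi_pos])
  have hc0 : 0 < cos θ₀ := cos_pos_of_mem_Ioo ⟨by linarith, h0⟩
  have hs1 : 0 < sin ν⁻¹ := sin_pos_of_pos_of_lt_pi hθ1 (by linarith [pi_pos])
  have hc1 : 0 < cos ν⁻¹ := cos_pos_of_mem_Ioo ⟨by linarith, by linarith⟩
  have hcot : cos ν⁻¹ / sin ν⁻¹ ≤ ν := by
    have := lt_tan hθ1 (h1.trans_lt h0)
    rw [tan_eq_sin_div_cos, lt_div_iff₀ hc1, inv_mul_eq_div, div_lt_iff₀ hν0] at this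
    rw [div_le_iff₀ hs1]
    linarith
  have hcot0 : 0 < cos ν⁻¹ / sin ν⁻¹ := div_pos hc1 hs1
  have hy1 : |y ν⁻¹| ≤ 1 := by
    rw [← sq_le_one_iff_abs_le_one]
    nlinarith [sq_nonneg (y' ν⁻¹)]
  have hy1' : |y' ν⁻¹| ≤ ν := by
    refine abs_le_of_sq_le_sq ?_ hν0.le
    nlinarith [sq_nonneg (y ν⁻¹)]
  have hg : (l * (cos ν⁻¹ / sin ν⁻¹) * y ν⁻¹ + y' ν⁻¹) ^ 2 ≤ (l * ν + ν) ^ 2 := by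
    rw [sq_le_sq, abs_of_pos (a := l * ν + ν) (by positivity)]
    refine (abs_add_le _ _).trans (add_le_add ?_ hy1')
    rw [abs_mul, abs_of_pos (by positivity)]
    calc l * (cos ν⁻¹ / sin ν⁻¹) * |y ν⁻¹| ≤ l * ν * 1 := by gcongr
      _ = l * ν := mul_one _
  have hy1s : y ν⁻¹ ^ 2 ≤ 1 := (sq_le_one_iff_abs_le_one _).2 hy1
  have hw1 : sin ν⁻¹ ^ (2 * l) ≤ (ν ^ (-l)) ^ 2 := by
    calc sin ν⁻¹ ^ (2 * l) ≤ ν⁻¹ ^ (2 * l) := rpow_le_rpow hs1.le (sin_le hθ1.le) (by linarith)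
      _ = (ν ^ (-l)) ^ 2 := by
        rw [inv_rpow hν0.le, ← rpow_neg hν0.le, ← rpow_natCast, ← rpow_mul hν0.le]
        congr 1
        push_cast
        ring
  have he1 : exp (l * (l - 1) / ν * (cos ν⁻¹ / sin ν⁻¹)) ≤ exp (l * (l - 1)) := by
    rw [exp_le_exp]
    calc l * (l - 1) / ν * (cos ν⁻¹ / sin ν⁻¹) ≤ l * (l - 1) / ν * ν := by gcongr
      _ = l * (l - 1) := by field_simp
  have hupper : sin ν⁻¹ ^ (2 * l) * exp (l * (l - 1) / ν * (cos ν⁻¹ / sin ν⁻¹)) *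
      (ν ^ 2 * y ν⁻¹ ^ 2 + (l * (cos ν⁻¹ / sin ν⁻¹) * y ν⁻¹ + y' ν⁻¹) ^ 2) ≤
        (ν ^ (-l)) ^ 2 * exp (l * (l - 1)) * (ν ^ 2 * 1 + (l * ν + ν) ^ 2) := by
    gcongr
  have hlower : sin θ₀ ^ (2 * l) * 1 * (ν ^ 2 * y θ₀ ^ 2 + 0) ≤
      sin θ₀ ^ (2 * l) * exp (l * (l - 1) / ν * (cos θ₀ / sin θ₀)) *
        (ν ^ 2 * y θ₀ ^ 2 + (l * (cos θ₀ / sin θ₀) * y θ₀ + y' θ₀) ^ 2) := by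
    gcongr
    · exact one_le_exp (by positivity)
    · positivity
  have h := hlower.trans (hH.trans hupper)
  have hw0 : 0 < sin θ₀ ^ (2 * l) := by positivity
  rw [div_mul_eq_mul_div, le_div_iff₀ hw0]
  refine le_of_mul_le_mul_left (a := ν ^ 2) ?_ (by positivity)
  linarith

end Energy

end GaussSum

namespace GaussSum

/-! ### Negative arguments: bounds in `k` and summation. -/

section NegativeArgument

open Set Filter Topology Real

theorem cos_arccos_inv_sqrt {x : ℝ} (hx : x < 0) : cos (arccos (√(1 - x))⁻¹) = (√(1 - x))⁻¹ := by
  have hR : 1 < √(1 - x) := by rw [lt_sqrt one_pos.le]; linarith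
  exact cos_arccos (by linarith [inv_pos.2 (one_pos.trans hR)]) (inv_le_one_of_one_le₀ hR.le)

theorem arccos_inv_sqrt_mem {x : ℝ} (hx : x < 0) : arccos (√(1 - x))⁻¹ ∈ Ioo 0 (π / 2) := by
  have hR : 1 < √(1 - x) := by rw [lt_sqrt one_pos.le]; linarith
  exact ⟨arccos_pos.2 (inv_lt_one_of_one_lt₀ hR),
    arccos_lt_pi_div_two.2 (inv_pos.2 (one_pos.trans hR))⟩

theorem one_sub_sqrt_inv_inv_sq {x : ℝ} (hx : x < 0) : 1 - (√(1 - x))⁻¹⁻¹ ^ 2 = x := by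
  rw [inv_inv, sq_sqrt (by linarith)]
  ring

theorem abs_pow_mul_gaussF_le_one {c x : ℝ} {k : ℕ} (hc : 1 / 2 ≤ c) (hx : x < 0)
    (hk : 2 * c < k + 2) :
    |√(1 - x) ^ (k + 1) * gaussF ((k : ℝ) / 2 + 1 / 2) ((k : ℝ) / 2 + 1) c x| ≤ 1 := by
  obtain ⟨y, y', z, h0, h0', hy, hd⟩ := exists_angular_solution k (c := c) (by linarith)
  have hN : 0 < ((k : ℝ) + 1) * (k + 2 - 2 * c) := mul_pos (by positivity) (by linarith)
  obtain ⟨hp, hp2⟩ := arccos_inv_sqrt_mem hx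
  have h := energy_le (by linarith) h0 h0' hd hp.le hp2
  have hyv := hy (arccos (√(1 - x))⁻¹)
  rw [cos_arccos_inv_sqrt hx, one_sub_sqrt_inv_inv_sq hx, inv_inv] at hyv
  rw [← hyv, ← sq_le_one_iff_abs_le_one]
  nlinarith [sq_nonneg (y' (arccos (√(1 - x))⁻¹))]

/-- The contiguous relation leads to the parameters `(k, c + 1)` and `(k + 2, c + 2)`, both covered
by the bound 1; its factor `ab` is the quadratic in `k`. -/
theorem abs_pow_mul_gaussF_le {c x : ℝ} {k : ℕ} (hc : 0 < c) (hx : x < 0) (hk : 2 * c < k) :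
    |√(1 - x) ^ (k + 1) * gaussF ((k : ℝ) / 2 + 1 / 2) ((k : ℝ) / 2 + 1) c x| ≤
      1 + |x| / (4 * c * (c + 1) * (1 - x)) * ((k + 1) * (k + 2)) := by
  have h1 := abs_pow_mul_gaussF_le_one (c := c + 1) (k := k) (by linarith) hx (by linarith)
  have h2 := abs_pow_mul_gaussF_le_one (c := c + 2) (k := k + 2) (by linarith) hx
    (by push_cast; linarith)
  have hR : √(1 - x) ^ 2 = 1 - x := sq_sqrt (by linarith)
  have hx1 : 0 < 1 - x := by linarith
  rw [gaussF_eq_add_gaussF_succ _ (by positivity) hc (by linarith)]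
  have hsplit : √(1 - x) ^ (k + 1) * (gaussF ((k : ℝ) / 2 + 1 / 2) ((k : ℝ) / 2 + 1) (c + 1) x +
      x * (((k : ℝ) / 2 + 1 / 2) * ((k : ℝ) / 2 + 1) / (c * (c + 1)) *
        gaussF ((k : ℝ) / 2 + 1 / 2 + 1) ((k : ℝ) / 2 + 1 + 1) (c + 2) x)) =
      √(1 - x) ^ (k + 1) * gaussF ((k : ℝ) / 2 + 1 / 2) ((k : ℝ) / 2 + 1) (c + 1) x +
      x / (4 * c * (c + 1) * (1 - x)) * ((k + 1) * (k + 2)) * (√(1 - x) ^ (k + 2 + 1) *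
        gaussF (((k + 2 : ℕ) : ℝ) / 2 + 1 / 2) (((k + 2 : ℕ) : ℝ) / 2 + 1) (c + 2) x) := by
    rw [show k + 2 + 1 = k + 1 + 2 by ring, pow_add _ (k + 1) 2, hR,
      show ((k + 2 : ℕ) : ℝ) / 2 + 1 / 2 = (k : ℝ) / 2 + 1 / 2 + 1 by push_cast; ring,
      show ((k + 2 : ℕ) : ℝ) / 2 + 1 = (k : ℝ) / 2 + 1 + 1 by push_cast; ring]
    field_simp
    ring
  rw [hsplit]
  refine (abs_add_le _ _).trans (add_le_add h1 ?_)
  rw [abs_mul, abs_mul, abs_div, abs_of_pos (a := 4 * c * (c + 1) * (1 - x)) (by positivity),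
    abs_of_pos (a := ((k : ℝ) + 1) * (k + 2)) (by positivity)]
  exact mul_le_of_le_one_right (by positivity) h2

theorem exists_abs_pow_mul_gaussF_le_rpow {c x : ℝ} (hc : 3 / 2 < c) (hx : x < 0) :
    ∃ C : ℝ, ∀ᶠ k : ℕ in atTop,
      |√(1 - x) ^ (k + 1) * gaussF ((k : ℝ) / 2 + 1 / 2) ((k : ℝ) / 2 + 1) c x| ≤
        C * (k : ℝ) ^ (-(c - 1 / 2)) := by
  obtain ⟨hp, hp2⟩ := arccos_inv_sqrt_mem hx
  set θ := arccos (√(1 - x))⁻¹ with hθ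
  set l := c - 1 / 2 with hl
  have hl1 : 1 ≤ l := by linarith
  set B := exp (l * (l - 1)) * (1 + (l + 1) ^ 2) / sin θ ^ (2 * l) with hB
  refine ⟨√B * 2 ^ l, ?_⟩
  -- Large enough that `ν ≥ k/2 ≥ θ⁻¹` and `ν > l` for the `ν` below.
  filter_upwards [eventually_ge_atTop ⌈4 * c + 2 * θ⁻¹⌉₊] with k hk
  have hk' : 4 * c + 2 * θ⁻¹ ≤ k := Nat.ceil_le.1 hk
  have hθi : 0 < θ⁻¹ := inv_pos.2 hp
  obtain ⟨y, y', z, h0, h0', hy, hd⟩ := exists_angular_solution k (c := c) (by linarith)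
  -- Chosen so that `ν² - l² = (k + 1)(k + 2 - 2c)`.
  set ν : ℝ := k + 3 / 2 - c with hν
  have hνk : (k : ℝ) / 2 ≤ ν := by linarith
  have h := sq_le_of_weighted_energy (l := l) (ν := ν) (θ₀ := θ) hl1 (by linarith) h0 h0'
    (z := z) (fun t ht => by
      obtain ⟨d1, d2, d3⟩ := hd t ht
      refine ⟨d1, d2, ?_⟩
      rw [hν, hl]
      linear_combination d3) (inv_le_of_inv_le₀ hp (by linarith)) hp2
  have hyv := hy θ
  rw [hθ, cos_arccos_inv_sqrt hx, one_sub_sqrt_inv_inv_sq hx, inv_inv, ← hθ] at hyv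
  rw [← hyv]
  have hs : 0 < sin θ := sin_pos_of_pos_of_lt_pi hp (by linarith [pi_pos])
  have hB0 : 0 ≤ B := by positivity
  have hk0 : (0 : ℝ) < k := by linarith
  have hν0 : 0 < ν := by linarith
  have h1 : |y θ| ≤ √B * ν ^ (-l) := by
    refine abs_le_of_sq_le_sq ?_ (by positivity)
    rwa [mul_pow, sq_sqrt hB0]
  refine h1.trans ?_
  rw [mul_assoc]
  refine mul_le_mul_of_nonneg_left ?_ (sqrt_nonneg _)
  calc ν ^ (-l) ≤ ((k : ℝ) / 2) ^ (-l) :=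
        rpow_le_rpow_of_nonpos (by positivity) hνk (by linarith)
    _ = 2 ^ l * (k : ℝ) ^ (-l) := by
        rw [div_rpow hk0.le two_pos.le, rpow_neg two_pos.le, div_inv_eq_mul, mul_comm]

theorem summable_term_of_neg {η c x : ℝ} (hx : x < 0)
    (h : (0 < c ∧ c ≤ 3 / 2 ∧ η > √(1 + |x|) - 1) ∨ (c > 3 / 2 ∧ η ≥ √(1 + |x|) - 1)) :
    Summable fun k : ℕ => |term η c x k| := by
  rw [abs_of_neg hx, ← sub_eq_add_neg] at h
  set R := √(1 - x) with hRdef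
  have hR : 1 < R := by rw [hRdef, lt_sqrt one_pos.le]; linarith
  have hR0 : 0 < R := by linarith
  have hRsq : R ^ 2 = 1 - x := sq_sqrt (by linarith)
  have hη : R ≤ 1 + η := by rcases h with h | h <;> linarith [h.2]
  have hη0 : 0 < 1 + η := by linarith
  set q := R / (1 + η) with hq
  have hq0 : 0 ≤ q := by positivity
  -- Of the factor `(1 - x)^k = R^(2k)`, one `R^k` goes into `q^k` and the other, completed to
  -- `R^(k+1)`, into the angular solution.
  have hterm : ∀ k, ‖|term η c x k|‖ = R⁻¹ * (q ^ k *
      |R ^ (k + 1) * gaussF ((k : ℝ) / 2 + 1 / 2) ((k : ℝ) / 2 + 1) c x|) := fun k => by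
    rw [norm_eq_abs, abs_abs, term, abs_mul, abs_mul, ← hRsq,
      abs_of_nonneg (a := (R ^ 2 / (1 + η)) ^ k) (by positivity),
      abs_of_nonneg (a := R ^ (k + 1)) (by positivity), hq, div_pow, div_pow]
    field_simp
    ring
  rcases h with ⟨hc, -, h⟩ | ⟨hc, -⟩
  · have hq1 : ‖q‖ < 1 := by
      rw [norm_of_nonneg hq0, hq, div_lt_one hη0]
      linarith
    set A := |x| / (4 * c * (c + 1) * (1 - x))
    have hs := fun n : ℕ => summable_pow_mul_geometric_of_norm_lt_one n hq1
    refine Summable.of_norm_bounded_eventually_nat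
      (g := fun k : ℕ => R⁻¹ * (q ^ k * (1 + A * ((k + 1) * (k + 2))))) ?_ ?_
    · refine ((((hs 2).mul_left A).add ((hs 1).mul_left (3 * A))).add
        ((hs 0).mul_left (1 + 2 * A))).mul_left R⁻¹ |>.congr fun k => ?_
      ring
    · filter_upwards [eventually_gt_atTop ⌈2 * c⌉₊] with k hk
      rw [hterm]
      have := abs_pow_mul_gaussF_le hc hx (Nat.lt_of_ceil_lt hk)
      gcongr
  · have hq1 : q ≤ 1 := (div_le_one hη0).2 hη
    obtain ⟨C, hC⟩ := exists_abs_pow_mul_gaussF_le_rpow hc hx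
    refine Summable.of_norm_bounded_eventually_nat
      (g := fun k : ℕ => R⁻¹ * (C * (k : ℝ) ^ (-(c - 1 / 2)))) ?_ ?_
    · exact ((summable_nat_rpow.2 (by linarith)).mul_left C).mul_left _
    · filter_upwards [hC] with k hk
      rw [hterm]
      refine mul_le_mul_of_nonneg_left ?_ (by positivity)
      exact (mul_le_of_le_one_left (abs_nonneg _) (pow_le_one₀ hq0 hq1)).trans hk

end NegativeArgument

end GaussSum

theorem theorem2 (η c x : ℝ) :
    (0 < x → x < 1 →
      ((0 < c ∧ c ≤ 3 / 2 ∧ η > Real.sqrt x) ∨ (c > 3 / 2 ∧ η ≥ Real.sqrt x)) →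
        Summable fun k : ℕ => |GaussSum.term η c x k|) ∧
    (x < 0 →
      ((0 < c ∧ c ≤ 3 / 2 ∧ η > Real.sqrt (1 + |x|) - 1) ∨
        (c > 3 / 2 ∧ η ≥ Real.sqrt (1 + |x|) - 1)) →
        Summable fun k : ℕ => |GaussSum.term η c x k|) :=
  ⟨GaussSum.summable_term_of_pos, GaussSum.summable_term_of_neg⟩
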